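/- Let $\mathbb A$ be a countably infinite set of atoms, $\mathrm{Sb}$ the monoid of functions $m:\mathbb A\to\mathbb A$ with $m(a)\neq a$ for only finitely many $a$, and $\mathrm{Perm}$ the group of bijections in $\mathrm{Sb}$. For $M\in\{\mathrm{Sb},\mathrm{Perm}\}$, a finite set $C\subset\mathbb A$ *supports* an element $x$ of an $M$-set if $m_1x=m_2x$ whenever $m_1|_C=m_2|_C$; an $M$-set is *nominal* if each of its elements has a finite support, and $M\text{-}\mathrm{Nom}$ is the category of nominal $M$-sets and equivariant maps. Let $U:\mathrm{Sb}\text{-}\mathrm{Nom}\to\mathrm{Perm}\text{-}\mathrm{Nom}$ be the forgetful functor. For a nominal $\mathrm{Perm}$-set $X$ let $FX$ be the nominal $\mathrm{Sb}$-set of classes $[m,x]$ ($m\in\mathrm{Sb}$, $x\in X$) under the least equivalence relation with $(m,gx)\sim(mg,x)$ for $g\in\mathrm{Perm}$ and $(m,x)\sim(m',x)$ if $m|_C=m'|_C$ for some finite support $C$ of $x$, with action $n[m,x]=[nm,x]$. For nominal $\mathrm{Sb}$-sets $X,Y$, let $X\to_{\mathrm{Sb}}Y$ be the nominal $\mathrm{Sb}$-set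 of finitely supported equivariant maps $f:\mathrm{Sb}\times X\to Y$ with action $(m f)(n,x)=f(nm,x)$. In a $\mathrm{Perm}$-set write $\mathrm{supp}(x)$ for the least finite support of a finitely supported $x$, and $x\mathrel{\#}y$ if $x$ and $y$ have disjoint finite supports; for nominal $\mathrm{Perm}$-sets $X,Y$ put $X*Y=\{(x,y)\mid x\mathrel{\#}y\}$. The *magic wand* $X\multimap Y$ is the nominal $\mathrm{Perm}$-set of finitely supported partial functions $f:X\rightharpoonup Y$ (with action $(gf)(x)=g\,f(g^{-1}x)$) such that $f(x)$ is defined iff $f\mathrel{\#}x$, and $\mathrm{supp}(f)=\bigcup_{x\in\mathrm{dom} f}\mathrm{supp}(f(x))\setminus\mathrm{supp}(x)$; it is functorial in $Y$ by transposing $(X\multimap Y)*X\xrightarrow{\mathrm{ev}}Y\to Y'$. Let $\Sigma$ be a nominal $\mathrm{Perm}$-set and $O$ a nominal $\mathrm{Sb}$-set. Consider the functors $S(X)=UO\times(\Sigma\multimap X)$ on $\mathrm{Perm}\text{-}\mathrm{Nom}$, whose coalgebras are the separated automata, and $B_{\mathrm{Sb}}(X)=O\times(F\Sigma\to_{\mathrm{Sb}}X)$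 on $\mathrm{Sb}\text{-}\mathrm{Nom}$. For each nominal $\mathrm{Sb}$-set $Y$ let $\phi^{-1}_Y:U(F\Sigma\to_{\mathrm{Sb}}Y)\to(\Sigma\multimap UY)$ be the transpose of the map $(f,x)\mapsto f(\mathrm{id},[\mathrm{id},x])$ defined for $f\mathrel{\#}x$; with $\lambda_Y^{-1}=\mathrm{id}_{UO}\times\phi_Y^{-1}:UB_{\mathrm{Sb}}(Y)\to SU(Y)$ (a natural transformation), $\overline U:\mathrm{CoAlg}(B_{\mathrm{Sb}})\to\mathrm{CoAlg}(S)$ is the functor $\overline U(X,\gamma)=(UX,\lambda_X^{-1}\circ U\gamma)$, acting as $U$ on morphisms. Finally, let $(F\Sigma)^*$ be the nominal $\mathrm{Sb}$-set of words over $F\Sigma$ and $\zeta$ the $B_{\mathrm{Sb}}$-coalgebra structure on the set $(F\Sigma)^*\to_{\mathrm{Sb}}O$ of $\mathrm{Sb}$-nominal languages that pairs the output $L\mapsto L(\mathrm{id},\varepsilon)$ with the transpose of the transition function $\delta(L,a)(n,w)=L(n,(na)w)$. Then: 1. each $\phi_Y^{-1}$ is indeed an isomorphism, and its inverse $\phi_Y:(\Sigma\multimap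 UY)\to U(F\Sigma\to_{\mathrm{Sb}}Y)$ satisfies $\phi_Y(\psi)(m,[m,x])=m\cdot\psi(x)$ for all $m\in\mathrm{Sb}$ and $\psi\mathrel{\#}x$; 2. $((F\Sigma)^*\to_{\mathrm{Sb}}O,\ \zeta)$ is a final $B_{\mathrm{Sb}}$-coalgebra; 3. $\overline U((F\Sigma)^*\to_{\mathrm{Sb}}O,\ \zeta)$ is a final $S$-coalgebra, and its carrier is $U((F\Sigma)^*\to_{\mathrm{Sb}}O)$, the set of $\mathrm{Sb}$-nominal languages. -/

import Mathlib

open CategoryTheory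

universe u

namespace SepAut

/-! ## Atoms, finite substitutions, finite permutations -/

/-- The countably infinite set of atoms. -/
def Atom : Type := ℕ

instance : Infinite Atom := inferInstanceAs (Infinite ℕ)

instance : Countable Atom := inferInstanceAs (Countable ℕ)

instance : DecidableEq Atom := inferInstanceAs (DecidableEq ℕ)

/-- The monoid `Sb` of finite substitutions, under composition. -/
def sbMonoid : Submonoid (Function.End Atom) where
  carrier := {m | {a | m a ≠ a}.Finite}
  one_mem' := by
    have h : {a : Atom | (1 : Function.End Atom) a ≠ a} = ∅ :=
      Set.eq_empty_of_forall_notMem fun _ ha => ha rfl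
    simp only [Set.mem_ofPred_eq, h, Set.finite_empty]
  mul_mem' := by
    intro m n hm hn
    refine (Set.Finite.union hm hn).subset ?_
    intro a ha
    by_contra hc
    simp only [Set.mem_union, Set.mem_ofPred_eq, not_or, not_not] at hc
    apply ha
    change m (n a) = a
    rw [hc.2, hc.1]

/-- The group `Perm` of finite permutations. -/
def permGroup : Subgroup (Equiv.Perm Atom) where
  carrier := {g | {a | g a ≠ a}.Finite}
  one_mem' := by
    have h : {a : Atom | (1 : Equiv.Perm Atom) a ≠ a} = ∅ := by
      ext a; simp
    simp only [Set.mem_ofPred_eq, h, Set.finite_empty]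
  mul_mem' := by
    intro m n hm hn
    refine (Set.Finite.union hm hn).subset ?_
    intro a ha
    by_contra hc
    simp only [Set.mem_union, Set.mem_ofPred_eq, not_or, not_not] at hc
    apply ha
    change m (n a) = a
    rw [hc.2, hc.1]
  inv_mem' := by
    intro g hg
    refine Set.Finite.subset hg ?_
    intro a ha hc
    exact ha (by rw [Equiv.Perm.inv_eq_iff_eq]; exact hc.symm)

abbrev Sb : Type := ↥sbMonoid

abbrev Perm : Type := ↥permGroup

/-- The inclusion of `Perm` into `Sb`. -/
def permToSb : Perm →* Sb where
  toFun g := ⟨fun a => (g : Equiv.Perm Atom) a, g.2⟩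
  map_one' := rfl
  map_mul' _ _ := rfl

theorem permToSb_smul (g : Perm) (a : Atom) : permToSb g • a = g • a := rfl

/-! ## Supports -/

/-- The finite set `C` of atoms is an `M`-support of `x`. -/
def IsSupport (M : Type*) [SMul M Atom] {X : Type*} [SMul M X] (C : Finset Atom) (x : X) : Prop :=
  ∀ m₁ m₂ : M, (∀ a ∈ C, m₁ • a = m₂ • a) → m₁ • x = m₂ • x

/-- `x` has a finite `Perm`-support. -/
def FinSupp {X : Type*} [SMul Perm X] (x : X) : Prop :=
  ∃ C : Finset Atom, IsSupport Perm C x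

/-- The least finite `Perm`-support of `x` (for `x` with a finite support), as the intersection of
all finite supports. -/
def supp {X : Type*} [SMul Perm X] (x : X) : Set Atom :=
  {a | ∀ C : Finset Atom, IsSupport Perm C x → a ∈ C}

/-- `x` and `y` are separated: they have disjoint finite supports. -/
def Separated {X Y : Type*} [SMul Perm X] [SMul Perm Y] (x : X) (y : Y) : Prop :=
  ∃ C D : Finset Atom, Disjoint C D ∧ IsSupport Perm C x ∧ IsSupport Perm D y

/-! ### Helper facts about finite permutations -/

/-- The transposition of two atoms. -/
def swp (a b : Atom) : Perm :=
  ⟨Equiv.swap a b, by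
    refine Set.Finite.subset (Set.toFinite {a, b}) ?_
    intro c hc
    by_contra h
    simp only [Set.mem_insert_iff, Set.mem_singleton_iff, not_or] at h
    exact hc (Equiv.swap_apply_of_ne_of_ne h.1 h.2)⟩

theorem swp_left (a b : Atom) : swp a b • a = b := Equiv.swap_apply_left a b

theorem swp_ne {a b c : Atom} (h : c ≠ a) (h' : c ≠ b) : swp a b • c = c :=
  Equiv.swap_apply_of_ne_of_ne h h'

theorem exists_fresh (C D E : Finset Atom) :
    ∃ g : Perm, (∀ a ∈ C, g • a = a) ∧ ∀ a ∈ D, a ∉ C → g • a ∉ E := by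
  induction D using Finset.induction_on with
  | empty => exact ⟨1, fun a _ => one_smul _ a, by simp⟩
  | insert d D hd ih =>
    obtain ⟨g, hC, hD⟩ := ih
    by_cases hdC : d ∈ C
    · refine ⟨g, hC, ?_⟩
      intro a ha haC
      rcases Finset.mem_insert.1 ha with rfl | ha
      · exact absurd hdC haC
      · exact hD a ha haC
    · obtain ⟨e, he⟩ := Infinite.exists_notMem_finset (C ∪ D.image (fun a => g • a) ∪ E)
      simp only [Finset.mem_union, not_or] at he
      refine ⟨swp (g • d) e * g, ?_, ?_⟩
      · intro a ha
        rw [mul_smul, hC a ha]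
        refine swp_ne ?_ ?_
        · intro h
          have : g • a = g • d := by rw [hC a ha, h]
          exact hdC ((smul_left_cancel g this) ▸ ha)
        · rintro rfl
          exact he.1.1 ha
      · intro a ha haC
        rw [mul_smul]
        rcases Finset.mem_insert.1 ha with rfl | ha
        · rw [swp_left]; exact he.2
        · rw [swp_ne]
          · exact hD a ha haC
          · intro h
            exact hd ((smul_left_cancel g h) ▸ ha)
          · intro h
            exact he.1.2 (Finset.mem_image.2 ⟨a, ha, h⟩)

theorem exists_extend (C : Finset Atom) (f : Atom → Atom) (hf : Set.InjOn f C) :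
    ∃ g : Perm, ∀ a ∈ C, g • a = f a := by
  induction C using Finset.induction_on with
  | empty => exact ⟨1, by simp⟩
  | insert d C hd ih =>
    obtain ⟨g, hg⟩ := ih (hf.mono (by simp))
    refine ⟨swp (g • d) (f d) * g, ?_⟩
    intro a ha
    rw [mul_smul]
    rcases Finset.mem_insert.1 ha with rfl | ha
    · exact swp_left _ _
    · have had : a ≠ d := fun h => hd (h ▸ ha)
      rw [swp_ne, hg a ha]
      · intro h
        exact had (smul_left_cancel g h)
      · rw [hg a ha]
        intro h
        exact had (hf (by simp [ha]) (by simp) h)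

/-! ### Helper facts about supports -/

section Supports

variable {X Y : Type*} [MulAction Perm X] [MulAction Perm Y]

theorem isSupport_iff {C : Finset Atom} {x : X} :
    IsSupport Perm C x ↔ ∀ g : Perm, (∀ a ∈ C, g • a = a) → g • x = x := by
  constructor
  · intro h g hg
    have := h g 1 (fun a ha => by rw [hg a ha, one_smul])
    rwa [one_smul] at this
  · intro h g k hgk
    have := h (k⁻¹ * g) (fun a ha => by rw [mul_smul, hgk a ha, inv_smul_smul])
    rw [mul_smul, inv_smul_eq_iff] at this
    exact this

theorem IsSupport.smul {M : Type*} [Monoid M] [MulAction M Atom] {X : Type*} [MulAction M X]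
    {C : Finset Atom} {x : X} (h : IsSupport M C x) (m : M) :
    IsSupport M (C.image fun a => m • a) (m • x) := by
  intro m₁ m₂ hm
  rw [smul_smul, smul_smul]
  apply h
  intro a ha
  rw [mul_smul, mul_smul]
  exact hm _ (Finset.mem_image_of_mem _ ha)

theorem IsSupport.inter {C D : Finset Atom} {x : X} (hC : IsSupport Perm C x)
    (hD : IsSupport Perm D x) : IsSupport Perm (C ∩ D) x := by
  rw [isSupport_iff]
  intro g hg
  have hfin : {a : Atom | g • a ≠ a}.Finite := g.2
  obtain ⟨k, hkD, hkC⟩ := exists_fresh D C hfin.toFinset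
  have hkx : k • x = x := isSupport_iff.1 hD k hkD
  have hs := hC.smul k
  rw [hkx] at hs
  refine isSupport_iff.1 hs g ?_
  intro a ha
  obtain ⟨c, hc, rfl⟩ := Finset.mem_image.1 ha
  by_cases hcD : c ∈ D
  · simp only [hkD c hcD]
    exact hg c (Finset.mem_inter.2 ⟨hc, hcD⟩)
  · have := hkC c hc hcD
    simpa using this

theorem exists_supp {x : X} (h : FinSupp x) :
    ∃ S : Finset Atom, (S : Set Atom) = supp x ∧ IsSupport Perm S x := by
  obtain ⟨S, hS, hmin⟩ := (measure Finset.card).wf.has_min {C | IsSupport Perm C x} h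
  refine ⟨S, ?_, hS⟩
  ext a
  constructor
  · intro ha C hC
    have h1 : ¬ (S ∩ C).card < S.card := hmin (S ∩ C) (IsSupport.inter hS hC)
    have h2 : S ∩ C = S := Finset.eq_of_subset_of_card_le Finset.inter_subset_left (not_lt.1 h1)
    exact Finset.inter_eq_left.1 h2 ha
  · intro ha
    exact ha S hS

theorem supp_subset {C : Finset Atom} {x : X} (h : IsSupport Perm C x) : supp x ⊆ C :=
  fun _ ha => ha C h

theorem smul_eq_self_of_supp {x : X} (h : FinSupp x) {g : Perm} (hg : ∀ a ∈ supp x, g • a = a) :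
    g • x = x := by
  obtain ⟨S, hS, hS'⟩ := exists_supp h
  exact isSupport_iff.1 hS' g (fun a ha => hg a (hS ▸ ha))

theorem smul_eq_smul_of_supp {x : X} (h : FinSupp x) {g k : Perm}
    (hg : ∀ a ∈ supp x, g • a = k • a) : g • x = k • x := by
  obtain ⟨S, hS, hS'⟩ := exists_supp h
  exact hS' g k (fun a ha => hg a (hS ▸ ha))

theorem FinSupp.smul {x : X} (h : FinSupp x) (g : Perm) : FinSupp (g • x) := by
  obtain ⟨C, hC⟩ := h
  exact ⟨_, hC.smul g⟩

theorem smul_mem_supp {x : X} (g : Perm) {a : Atom} : g • a ∈ supp (g • x) ↔ a ∈ supp x := by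
  have key : ∀ (k : Perm) (y : X) (b : Atom), b ∈ supp y → k • b ∈ supp (k • y) := by
    intro k y b hb C hC
    have h1 := hC.smul k⁻¹
    rw [inv_smul_smul] at h1
    obtain ⟨c, hc, h2⟩ := Finset.mem_image.1 (hb _ h1)
    rw [← h2]
    simpa using hc
  constructor
  · intro h
    have := key g⁻¹ _ _ h
    simpa using this
  · exact key g x a

theorem mem_supp_smul {x : X} (g : Perm) {a : Atom} : a ∈ supp (g • x) ↔ g⁻¹ • a ∈ supp x := by
  rw [← smul_mem_supp (x := x) g, smul_inv_smul]

theorem separated_iff {x : X} {y : Y} (hx : FinSupp x) (hy : FinSupp y) :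
    Separated x y ↔ ∀ a ∈ supp x, a ∉ supp y := by
  constructor
  · rintro ⟨C, D, hCD, hC, hD⟩ a ha hb
    exact Finset.disjoint_left.1 hCD (supp_subset hC ha) (supp_subset hD hb)
  · intro h
    obtain ⟨C, hC, hC'⟩ := exists_supp hx
    obtain ⟨D, hD, hD'⟩ := exists_supp hy
    refine ⟨C, D, ?_, hC', hD'⟩
    rw [Finset.disjoint_left]
    intro a ha hb
    exact h a (hC ▸ ha) (hD ▸ hb)

theorem Separated.smul {x : X} {y : Y} (h : Separated x y) (g : Perm) :
    Separated (g • x) (g • y) := by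
  obtain ⟨C, D, hCD, hC, hD⟩ := h
  refine ⟨_, _, ?_, hC.smul g, hD.smul g⟩
  rw [Finset.disjoint_left] at hCD ⊢
  intro a ha hb
  obtain ⟨c, hc, rfl⟩ := Finset.mem_image.1 ha
  obtain ⟨d, hd, h2⟩ := Finset.mem_image.1 hb
  exact hCD hc ((smul_left_cancel g h2) ▸ hd)

theorem exists_fresh_supp {x : X} (hx : FinSupp x) (C E : Finset Atom)
    (h : ∀ a ∈ supp x, a ∉ C) :
    ∃ g : Perm, (∀ a ∈ C, g • a = a) ∧ ∀ a ∈ supp (g • x), a ∉ E := by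
  obtain ⟨S, hS, -⟩ := exists_supp hx
  obtain ⟨g, hg, hg'⟩ := exists_fresh C S E
  refine ⟨g, hg, ?_⟩
  intro a ha
  rw [mem_supp_smul] at ha
  have := hg' (g⁻¹ • a) (by rw [← hS] at ha; exact ha) (h _ ha)
  rwa [smul_inv_smul] at this

end Supports

/-! ## The categories of nominal `M`-sets -/

/-- A nominal `M`-set, for a monoid `M` acting on the atoms (here `M` is `Sb` or `Perm`): an
`M`-set in which every element has a finite `M`-support. -/
structure NomSet (M : Type) [Monoid M] [MulAction M Atom] where
  carrier : Type u
  [act : MulAction M carrier]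
  nominal : ∀ x : carrier, ∃ C : Finset Atom, IsSupport M C x

namespace NomSet

section Basic

variable {M : Type} [Monoid M] [MulAction M Atom]

instance : CoeSort (NomSet.{u} M) (Type u) := ⟨NomSet.carrier⟩

instance (X : NomSet.{u} M) : MulAction M X := X.act

/-- Equivariant maps. -/
@[ext]
structure Hom (X Y : NomSet.{u} M) where
  toFun : X → Y
  map_smul : ∀ (m : M) (x : X), toFun (m • x) = m • toFun x

instance (X Y : NomSet.{u} M) : FunLike (Hom X Y) X Y where
  coe := Hom.toFun
  coe_injective _ _ h := Hom.ext h

/-- The category of nominal `M`-sets and equivariant maps. -/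
instance : Category (NomSet.{u} M) where
  Hom := Hom
  id X := ⟨fun x => x, fun _ _ => rfl⟩
  comp f g := ⟨fun x => g.toFun (f.toFun x), fun m x => by rw [f.map_smul, g.map_smul]⟩

instance : ConcreteCategory (NomSet.{u} M) Hom where
  hom f := f
  ofHom f := f

theorem hom_smul {X Y : NomSet.{u} M} (f : X ⟶ Y) (m : M) (x : X) : f (m • x) = m • f x :=
  Hom.map_smul f m x

theorem isSupport_map {X Y : NomSet.{u} M} (f : X ⟶ Y) {C : Finset Atom} {x : X}
    (h : IsSupport M C x) : IsSupport M C (f x) := by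
  intro m₁ m₂ hm
  rw [← hom_smul, ← hom_smul, h m₁ m₂ hm]

/-- The Cartesian product of nominal `M`-sets. -/
def prod (X Y : NomSet.{u} M) : NomSet.{u} M where
  carrier := X × Y
  nominal := by
    rintro ⟨x, y⟩
    obtain ⟨C, hC⟩ := X.nominal x
    obtain ⟨D, hD⟩ := Y.nominal y
    refine ⟨C ∪ D, fun m₁ m₂ hm => Prod.ext ?_ ?_⟩
    · exact hC _ _ (fun a ha => hm a (Finset.mem_union_left _ ha))
    · exact hD _ _ (fun a ha => hm a (Finset.mem_union_right _ ha))

/-- Pairing of maps into a product. -/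
def pair {Z X Y : NomSet.{u} M} (f : Z ⟶ X) (g : Z ⟶ Y) : Z ⟶ prod X Y :=
  Hom.mk (X := Z) (Y := prod X Y) (fun z => (f z, g z))
    (fun m z => Prod.ext (hom_smul f m z) (hom_smul g m z))

/-- The nominal `M`-set of words over `X`, with the letterwise action. -/
def words (X : NomSet.{u} M) : NomSet.{u} M where
  carrier := List X
  act :=
    { smul := fun m w => w.map (fun x => m • x)
      one_smul := fun w => by
        change w.map (fun x => (1 : M) • x) = w
        simp
      mul_smul := fun m n w => by
        change w.map (fun x => (m * n) • x) = (w.map (fun x => n • x)).map (fun x => m • x)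
        simp [mul_smul] }
  nominal := by
    intro w
    induction w with
    | nil => exact ⟨∅, fun _ _ _ => rfl⟩
    | cons x w ih =>
      obtain ⟨C, hC⟩ := ih
      obtain ⟨D, hD⟩ := X.nominal x
      refine ⟨C ∪ D, fun m₁ m₂ hm => ?_⟩
      have h1 := hC _ _ (fun a ha => hm a (Finset.mem_union_left _ ha))
      have h2 := hD _ _ (fun a ha => hm a (Finset.mem_union_right _ ha))
      change m₁ • x :: w.map (fun x => m₁ • x) = m₂ • x :: w.map (fun x => m₂ • x)
      rw [h2]
      exact congrArg _ h1

/-! ### Exponents -/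

/-- The exponent of `M`-sets: equivariant maps `M × X → Y`. -/
def ExpAll (X Y : NomSet.{u} M) : Type u :=
  {f : M × X → Y // ∀ (k n : M) (x : X), f (k * n, k • x) = k • f (n, x)}

/-- The action on the exponent, `(m · f) (n, x) = f (n m, x)`. -/
instance (X Y : NomSet.{u} M) : MulAction M (ExpAll X Y) where
  smul m f := ⟨fun p => f.1 (p.1 * m, p.2), fun k n x => by
    change f.1 (k * n * m, k • x) = k • f.1 (n * m, x)
    rw [mul_assoc]
    exact f.2 k (n * m) x⟩
  one_smul f := Subtype.ext (funext fun p => by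
    change f.1 (p.1 * 1, p.2) = f.1 p
    rw [mul_one])
  mul_smul m n f := Subtype.ext (funext fun p => by
    change f.1 (p.1 * (m * n), p.2) = f.1 (p.1 * m * n, p.2)
    rw [mul_assoc])

/-- The exponent of nominal `M`-sets: the finitely supported elements of the exponent of
`M`-sets. -/
def exp (X Y : NomSet.{u} M) : NomSet.{u} M where
  carrier := {f : ExpAll X Y // ∃ C : Finset Atom, IsSupport M C f}
  act :=
    { smul := fun m f => ⟨m • f.1, by
        obtain ⟨C, hC⟩ := f.2
        exact ⟨_, hC.smul m⟩⟩
      one_smul := fun f => Subtype.ext (one_smul M f.1)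
      mul_smul := fun m n f => Subtype.ext (mul_smul m n f.1) }
  nominal := fun f => by
    obtain ⟨C, hC⟩ := f.2
    exact ⟨C, fun m₁ m₂ hm => Subtype.ext (hC m₁ m₂ hm)⟩

/-- The value at `(m, x)` of an element of the exponent. -/
def exp.app {X Y : NomSet.{u} M} (f : exp X Y) (m : M) (x : X) : Y := f.1.1 (m, x)

theorem exp.ext {X Y : NomSet.{u} M} {f g : exp X Y} (h : ∀ m x, exp.app f m x = exp.app g m x) :
    f = g :=
  Subtype.ext (Subtype.ext (funext fun p => h p.1 p.2))

theorem exp.smul_app {X Y : NomSet.{u} M} (k : M) (f : exp X Y) (m : M) (x : X) :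
    exp.app (k • f) m x = exp.app f (m * k) x := rfl

theorem exp.app_smul {X Y : NomSet.{u} M} (f : exp X Y) (k m : M) (x : X) :
    exp.app f (k * m) (k • x) = k • exp.app f m x := f.1.2 k m x

/-- Currying: `z ↦ ((m, x) ↦ g (m z, x))`. -/
def curry {Z X Y : NomSet.{u} M} (g : prod Z X ⟶ Y) : Z ⟶ exp X Y :=
  Hom.mk (X := Z) (Y := exp X Y)
    (fun z => ⟨⟨fun p => g (p.1 • z, p.2), fun k n x => by
        change g ((k * n) • z, k • x) = k • g (n • z, x)
        rw [mul_smul]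
        exact hom_smul g k (n • z, x)⟩, by
      obtain ⟨C, hC⟩ := Z.nominal z
      refine ⟨C, fun m₁ m₂ hm => Subtype.ext (funext fun p => ?_)⟩
      change g ((p.1 * m₁) • z, p.2) = g ((p.1 * m₂) • z, p.2)
      rw [mul_smul, mul_smul, hC m₁ m₂ hm]⟩)
    (fun m z => exp.ext fun n x => by
      change g (n • m • z, x) = g ((n * m) • z, x)
      rw [mul_smul])

/-- Post-composition on exponents. -/
def expMap (X : NomSet.{u} M) {Y Z : NomSet.{u} M} (h : Y ⟶ Z) : exp X Y ⟶ exp X Z :=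
  Hom.mk (X := exp X Y) (Y := exp X Z)
    (fun f => ⟨⟨fun p => h (f.1.1 p), fun k n x =>
        (congrArg h (f.1.2 k n x)).trans (hom_smul h k _)⟩, by
      obtain ⟨C, hC⟩ := f.2
      refine ⟨C, fun m₁ m₂ hm => Subtype.ext (funext fun p => ?_)⟩
      exact congrArg (fun e : ExpAll X Y => h (e.1 p)) (hC m₁ m₂ hm)⟩)
    (fun _ _ => rfl)

/-! ### Moore automata as coalgebras -/

/-- The functor `B_M X = O × (A →_M X)` for input alphabet `A` and output alphabet `O`. -/
def moore (A O : NomSet.{u} M) : NomSet.{u} M ⥤ NomSet.{u} M where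
  obj X := prod O (exp A X)
  map {X Y} h := Hom.mk (X := prod O (exp A X)) (Y := prod O (exp A Y))
    (fun p => (p.1, expMap A h p.2))
    (fun m p => Prod.ext rfl (hom_smul (expMap A h) m p.2))

/-- The output `L ↦ L(ε)` of a language, that is, its value at `(1, ε)`. -/
def langOut (A O : NomSet.{u} M) : exp (words A) O ⟶ O :=
  Hom.mk (X := exp (words A) O) (Y := O) (fun L => exp.app L 1 ([] : List A)) (fun m L => by
    have h := exp.app_smul L m 1 ([] : List A)
    rw [mul_one] at h
    refine Eq.trans ?_ h
    change exp.app L (1 * m) _ = _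
    rw [one_mul]
    rfl)

/-- The map `((L, a), w) ↦ L(aw)`, the right-hand side being the value at `(1, aw)`. -/
def langConsEv (A O : NomSet.{u} M) : prod (prod (exp (words A) O) A) (words A) ⟶ O :=
  Hom.mk (X := prod (prod (exp (words A) O) A) (words A)) (Y := O)
    (fun p => exp.app p.1.1 1 ((p.1.2 :: p.2 : List A)))
    (fun m p => by
      have h := exp.app_smul p.1.1 m 1 (p.1.2 :: p.2 : List A)
      rw [mul_one] at h
      refine Eq.trans ?_ h
      change exp.app p.1.1 (1 * m) _ = _
      rw [one_mul]
      rfl)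

/-- The transition function `(L, a) ↦ (w ↦ L(aw))` on languages. -/
def langDelta (A O : NomSet.{u} M) : prod (exp (words A) O) A ⟶ exp (words A) O :=
  curry (langConsEv A O)

/-- The Moore automaton `(A^* →_M O, ζ)` of all `M`-nominal languages; `ζ` pairs the output with
the transpose of the transition function. -/
def langCoalg (A O : NomSet.{u} M) : Endofunctor.Coalgebra (moore A O) where
  V := exp (words A) O
  str := pair (langOut A O) (curry (langDelta A O))

end Basic

end NomSet

abbrev PermNom := NomSet.{u} Perm

abbrev SbNom := NomSet.{u} Sb

open NomSet

/-! ## The forgetful functor and the free construction -/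

/-- The forgetful functor `U` restricting the action along the inclusion of `Perm` in `Sb`. -/
def forgetSb : SbNom.{u} ⥤ PermNom.{u} where
  obj Y :=
    { carrier := Y
      act := MulAction.compHom Y permToSb
      nominal := fun y => by
        obtain ⟨C, hC⟩ := Y.nominal y
        exact ⟨C, fun g k hgk => hC (permToSb g) (permToSb k) hgk⟩ }
  map {X Y} f := ⟨fun x => f x, fun g x => hom_smul f (permToSb g) x⟩

/-- The relation generating the equivalence relation on `Sb × X` that defines `F X`. -/
inductive FreeRel (X : PermNom.{u}) : Sb × X → Sb × X → Prop
  | assoc (m : Sb) (g : Perm) (x : X) : FreeRel X (m, g • x) (m * permToSb g, x)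
  | agree (m m' : Sb) (x : X) (C : Finset Atom) (hC : IsSupport Perm C x)
      (h : ∀ a ∈ C, m • a = m' • a) : FreeRel X (m, x) (m', x)

/-- The free nominal `Sb`-set `F X` on a nominal `Perm`-set: pairs `[m, x]` modulo the least
equivalence relation containing `FreeRel`, with `n · [m, x] = [n m, x]`. -/
def free (X : PermNom.{u}) : SbNom.{u} where
  carrier := Quot (FreeRel X)
  act :=
    { smul := fun n => Quot.map (fun p => (n * p.1, p.2)) (by
        rintro _ _ (⟨m, g, x⟩ | ⟨m, m', x, C, hC, h⟩)
        · have := FreeRel.assoc (n * m) g x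
          rwa [mul_assoc] at this
        · refine FreeRel.agree _ _ x C hC (fun a ha => ?_)
          rw [mul_smul, mul_smul, h a ha])
      one_smul := by
        rintro ⟨m, x⟩
        change Quot.mk _ (1 * m, x) = Quot.mk _ (m, x)
        rw [one_mul]
      mul_smul := by
        rintro n k ⟨m, x⟩
        change Quot.mk _ (n * k * m, x) = Quot.mk _ (n * (k * m), x)
        rw [mul_assoc] }
  nominal := by
    rintro ⟨m, x⟩
    obtain ⟨C, hC⟩ := X.nominal x
    refine ⟨C.image (fun a => m • a), fun m₁ m₂ hm => ?_⟩
    refine Quot.sound (FreeRel.agree _ _ x C hC (fun a ha => ?_))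
    rw [mul_smul, mul_smul]
    exact hm _ (Finset.mem_image_of_mem _ ha)

/-- The class `[m, x]` in `F X`. -/
def free.mk {X : PermNom.{u}} (m : Sb) (x : X) : free X := Quot.mk _ (m, x)

theorem free.smul_mk {X : PermNom.{u}} (n m : Sb) (x : X) :
    n • free.mk m x = free.mk (n * m) x := rfl

theorem free.mk_smul {X : PermNom.{u}} (m : Sb) (g : Perm) (x : X) :
    free.mk m (g • x) = free.mk (m * permToSb g) x :=
  Quot.sound (FreeRel.assoc m g x)

/-! ## Separated product and magic wand -/

/-- The separated product of nominal `Perm`-sets. -/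
def sepProd (X Y : PermNom.{u}) : PermNom.{u} where
  carrier := {p : X × Y // Separated p.1 p.2}
  act :=
    { smul := fun g p => ⟨g • p.1, p.2.smul g⟩
      one_smul := fun p => Subtype.ext (one_smul Perm p.1)
      mul_smul := fun g k p => Subtype.ext (mul_smul g k p.1) }
  nominal := fun p => by
    obtain ⟨C, hC⟩ := (prod X Y).nominal p.1
    exact ⟨C, fun g k h => Subtype.ext (hC g k h)⟩

/-- Partial functions from `X` to `Y`. -/
def PartialMap (X Y : PermNom.{u}) : Type u := X → Option Y

/-- The action on partial functions: `(g · f) (x) = g · f (g⁻¹ · x)`. -/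
instance (X Y : PermNom.{u}) : MulAction Perm (PartialMap X Y) where
  smul g f := fun x => (f (g⁻¹ • x)).map (fun y => g • y)
  one_smul f := funext fun x => by
    change (f ((1 : Perm)⁻¹ • x)).map (fun y => (1 : Perm) • y) = f x
    simp
  mul_smul g k f := funext fun x => by
    change (f ((g * k)⁻¹ • x)).map (fun y => (g * k) • y) =
      ((f (k⁻¹ • g⁻¹ • x)).map (fun y => k • y)).map (fun y => g • y)
    simp [mul_smul, Function.comp_def]

theorem PartialMap.smul_apply {X Y : PermNom.{u}} (g : Perm) (f : PartialMap X Y) (x : X) :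
    (g • f) x = (f (g⁻¹ • x)).map (fun y => g • y) := rfl

theorem PartialMap.smul_apply_smul {X Y : PermNom.{u}} (g : Perm) (f : PartialMap X Y) (x : X) :
    (g • f) (g • x) = (f x).map (fun y => g • y) := by
  rw [PartialMap.smul_apply, inv_smul_smul]

/-- A partial function is separating if it is finitely supported, is defined exactly at the
arguments separated from it, and its support is the union of the `supp (f x) \ supp x`. -/
structure IsSeparating {X Y : PermNom.{u}} (f : PartialMap X Y) : Prop where
  finSupp : FinSupp f
  defined : ∀ x, (f x).isSome ↔ Separated f x
  supp_eq : supp f = {a | ∃ x y, f x = some y ∧ a ∈ supp y ∧ a ∉ supp x}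

theorem IsSeparating.smul {X Y : PermNom.{u}} {f : PartialMap X Y} (hf : IsSeparating f)
    (g : Perm) : IsSeparating (g • f) where
  finSupp := hf.finSupp.smul g
  defined x := by
    have h1 : Separated (g • f) x ↔ Separated f (g⁻¹ • x) := by
      constructor
      · intro h
        have := h.smul g⁻¹
        rwa [inv_smul_smul] at this
      · intro h
        have := h.smul g
        rwa [smul_inv_smul] at this
    rw [h1, ← hf.defined, PartialMap.smul_apply, Option.isSome_map]
  supp_eq := by
    ext a
    rw [mem_supp_smul, hf.supp_eq]
    constructor
    · rintro ⟨x, y, hxy, hy, hx⟩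
      refine ⟨g • x, g • y, ?_, ?_, ?_⟩
      · rw [PartialMap.smul_apply_smul, hxy]; rfl
      · rwa [mem_supp_smul]
      · rwa [mem_supp_smul]
    · rintro ⟨x, y, hxy, hy, hx⟩
      rw [PartialMap.smul_apply, Option.map_eq_some_iff] at hxy
      obtain ⟨y', hy', rfl⟩ := hxy
      refine ⟨g⁻¹ • x, y', hy', ?_, ?_⟩
      · rwa [mem_supp_smul] at hy
      · rwa [smul_mem_supp]

/-- The magic wand: the nominal `Perm`-set of separating partial functions. -/
def wand (X Y : PermNom.{u}) : PermNom.{u} where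
  carrier := {f : PartialMap X Y // IsSeparating f}
  act :=
    { smul := fun g f => ⟨g • f.1, f.2.smul g⟩
      one_smul := fun f => Subtype.ext (one_smul Perm f.1)
      mul_smul := fun g k f => Subtype.ext (mul_smul g k f.1) }
  nominal := fun f => by
    obtain ⟨C, hC⟩ := f.2.finSupp
    exact ⟨C, fun g k h => Subtype.ext (hC g k h)⟩

theorem isSupport_wand {X Y : PermNom.{u}} {f : wand X Y} {C : Finset Atom} :
    IsSupport Perm C f ↔ IsSupport Perm C f.1 :=
  ⟨fun h g k hgk => congrArg Subtype.val (h g k hgk), fun h g k hgk => Subtype.ext (h g k hgk)⟩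

theorem supp_wand {X Y : PermNom.{u}} (f : wand X Y) : supp f = supp f.1 := by
  ext a
  simp only [supp, isSupport_wand]

theorem separated_wand {X Y : PermNom.{u}} {f : wand X Y} {x : X} :
    Separated f x ↔ Separated f.1 x := by
  simp only [Separated, isSupport_wand]

/-- Evaluation of the magic wand, on the separated product. -/
def wandEv (X Y : PermNom.{u}) : sepProd (wand X Y) X ⟶ Y :=
  Hom.mk (X := sepProd (wand X Y) X) (Y := Y)
    (fun p => (p.1.1.1 p.1.2).get ((p.1.1.2.defined _).2 (separated_wand.1 p.2)))
    (fun g p => by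
      have h : (g • p.1.1.1 : PartialMap X Y) (g • p.1.2) =
          (p.1.1.1 p.1.2).map (fun y => g • y) := PartialMap.smul_apply_smul g _ _
      have h' := (p.1.1.2.defined _).2 (separated_wand.1 p.2)
      have h2 : p.1.1.1 p.1.2 = some ((p.1.1.1 p.1.2).get h') := (Option.some_get h').symm
      rw [h2, Option.map_some] at h
      exact Option.get_of_eq_some _ h)

theorem some_wandEv {X Y : PermNom.{u}} (p : sepProd (wand X Y) X) :
    p.1.1.1 p.1.2 = some (wandEv X Y p) :=
  (Option.some_get _).symm

theorem wand_map_of_fix {X Y : PermNom.{u}} (f : wand X Y) {g : Perm}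
    (hg : ∀ a ∈ supp f.1, g • a = a) (x : X) : f.1 (g • x) = (f.1 x).map (fun y => g • y) := by
  have h := PartialMap.smul_apply_smul g f.1 x
  rwa [smul_eq_self_of_supp f.2.finSupp hg] at h

/-- Two separating partial functions that agree on all sufficiently fresh arguments are equal. -/
theorem wand_ext {X Y : PermNom.{u}} {f f' : wand X Y} (E : Finset Atom)
    (h : ∀ x : X, (∀ a ∈ supp x, a ∉ E) → f.1 x = f'.1 x) : f = f' := by
  have key : ∀ {f f' : wand X Y}, (∀ x : X, (∀ a ∈ supp x, a ∉ E) → f.1 x = f'.1 x) →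
      supp f.1 ⊆ supp f'.1 := by
    intro f f' h a ha
    obtain ⟨S, hS, -⟩ := exists_supp f.2.finSupp
    rw [f.2.supp_eq] at ha
    obtain ⟨x, y, hxy, hy, hx⟩ := ha
    have hsep : Separated f.1 x := (f.2.defined x).1 (by rw [hxy]; rfl)
    rw [separated_iff f.2.finSupp (X.nominal x)] at hsep
    have haS : a ∈ supp f.1 := by
      rw [f.2.supp_eq]
      exact ⟨x, y, hxy, hy, hx⟩
    obtain ⟨g, hg, hg'⟩ := exists_fresh_supp (X.nominal x) S E
      (fun b hb hb' => hsep b (hS ▸ hb') hb)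
    have hga : g • a = a := hg a (by rw [← hS] at haS; exact haS)
    have h1 := wand_map_of_fix f (g := g) (fun b hb => hg b (by rw [← hS] at hb; exact hb)) x
    rw [hxy, h _ hg'] at h1
    rw [f'.2.supp_eq]
    refine ⟨g • x, g • y, h1, ?_, ?_⟩
    · rw [← hga, smul_mem_supp]; exact hy
    · rw [← hga, smul_mem_supp]; exact hx
  have hsupp : supp f.1 = supp f'.1 := Set.Subset.antisymm (key h) (key fun x hx => (h x hx).symm)
  obtain ⟨S, hS, -⟩ := exists_supp f.2.finSupp
  refine Subtype.ext (funext fun x => ?_)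
  by_cases hx : ∀ a ∈ supp f.1, a ∉ supp x
  · obtain ⟨g, hg, hg'⟩ := exists_fresh_supp (X.nominal x) S E
      (fun b hb hb' => hx b (hS ▸ hb') hb)
    have h1 := wand_map_of_fix f (g := g) (fun b hb => hg b (by rw [← hS] at hb; exact hb)) x
    have h2 := wand_map_of_fix f' (g := g)
      (fun b hb => hg b (by rw [← hsupp, ← hS] at hb; exact hb)) x
    rw [h _ hg', h2] at h1
    exact (Option.map_injective (MulAction.injective g) h1).symm
  · have h1 : ¬ (f.1 x).isSome := by
      rw [f.2.defined, separated_iff f.2.finSupp (X.nominal x)]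
      exact hx
    have h2 : ¬ (f'.1 x).isSome := by
      rw [f'.2.defined, separated_iff f'.2.finSupp (X.nominal x), ← hsupp]
      exact hx
    rw [Option.not_isSome_iff_eq_none] at h1 h2
    rw [h1, h2]

/-! ### Currying for the magic wand -/

section Curry

variable {Z X Y : PermNom.{u}} (g : sepProd Z X ⟶ Y)

/-- The atoms on which the function `x ↦ g (z, x)` really depends. -/
def curryDom (z : Z) : Set Atom :=
  {a | ∃ (x : X) (h : Separated z x), a ∈ supp (g ⟨(z, x), h⟩) ∧ a ∉ supp x}

theorem separated_iff' {X Y : PermNom.{u}} {x : X} {y : Y} :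
    Separated x y ↔ ∀ a ∈ supp x, a ∉ supp y :=
  separated_iff (X.nominal x) (Y.nominal y)

theorem sepProd_smul_eq {z : Z} {x : X} (h : Separated z x) (k : Perm) {z' : Z} {x' : X}
    (hz : k • z = z') (hx : k • x = x') (h' : Separated z' x') :
    g ⟨(z', x'), h'⟩ = k • g ⟨(z, x), h⟩ := by
  subst hz hx
  exact hom_smul g k ⟨(z, x), h⟩

theorem supp_val_subset {z : Z} {x : X} (h : Separated z x) {a : Atom}
    (ha : a ∈ supp (g ⟨(z, x), h⟩)) : a ∈ supp z ∨ a ∈ supp x := by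
  obtain ⟨C, hC, hC'⟩ := exists_supp (Z.nominal z)
  obtain ⟨D, hD, hD'⟩ := exists_supp (X.nominal x)
  have hs : IsSupport Perm (C ∪ D) (g ⟨(z, x), h⟩) := by
    rw [isSupport_iff]
    intro k hk
    exact (sepProd_smul_eq g h k (isSupport_iff.1 hC' k fun b hb => hk b (by simp [hb]))
      (isSupport_iff.1 hD' k fun b hb => hk b (by simp [hb])) h).symm
  have := supp_subset hs ha
  rw [Finset.coe_union, hC, hD] at this
  exact this

theorem curryDom_subset (z : Z) : curryDom g z ⊆ supp z := by
  rintro a ⟨x, h, ha, hx⟩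
  exact (supp_val_subset g h ha).resolve_right hx

theorem curryDom_finite (z : Z) : (curryDom g z).Finite := by
  obtain ⟨C, hC, -⟩ := exists_supp (Z.nominal z)
  exact (Finset.finite_toSet C).subset (hC ▸ curryDom_subset g z)

/-- `y` is obtained from `g` at a fresh variant of `x`. -/
def CurryRel (z : Z) (x : X) (y : Y) : Prop :=
  ∃ (k : Perm) (h : Separated z (k • x)), (∀ a ∈ curryDom g z, k • a = a) ∧
    y = k⁻¹ • g ⟨(z, k • x), h⟩

theorem exists_curryRel {z : Z} {x : X} (hx : ∀ a ∈ supp x, a ∉ curryDom g z) :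
    ∃ y, CurryRel g z x y := by
  obtain ⟨C, hC, -⟩ := exists_supp (Z.nominal z)
  obtain ⟨k, hk, hk'⟩ := exists_fresh_supp (X.nominal x) (curryDom_finite g z).toFinset C
    (by simpa using hx)
  refine ⟨_, k, ?_, by simpa using hk, rfl⟩
  rw [separated_iff']
  intro a ha ha'
  exact hk' a ha' (by rw [← hC] at ha; exact ha)

theorem curryRel_unique {z : Z} {x : X} {y y' : Y} (h : CurryRel g z x y)
    (h' : CurryRel g z x y') : y = y' := by
  obtain ⟨k, hk, hkD, rfl⟩ := h
  obtain ⟨l, hl, hlD, rfl⟩ := h'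
  obtain ⟨C, hC, hC'⟩ := exists_supp (Z.nominal z)
  obtain ⟨D, hD, hD'⟩ := exists_supp (X.nominal (k • x))
  have hkC : ∀ a ∈ C, a ∉ D := by
    intro a ha hb
    exact separated_iff'.1 hk a (by rw [← hC]; exact ha) (by rw [← hD]; exact hb)
  have hlC : ∀ a ∈ D, (l * k⁻¹) • a ∉ C := by
    intro a ha hb
    refine separated_iff'.1 hl _ (by rw [← hC]; exact hb) ?_
    rw [mul_smul, smul_mem_supp]
    have : a ∈ supp (k • x) := by rw [← hD]; exact ha
    rwa [mem_supp_smul] at this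
  obtain ⟨s, hs⟩ := exists_extend (C ∪ D) (fun a => if a ∈ C then a else (l * k⁻¹) • a) (by
    intro a ha b hb hab
    simp only [Finset.coe_union, Set.mem_union, Finset.mem_coe] at ha hb
    by_cases haC : a ∈ C <;> by_cases hbC : b ∈ C
    · simpa [haC, hbC] using hab
    · simp only [haC, hbC, if_true, if_false] at hab
      exact absurd (hab ▸ haC) (hlC b (hb.resolve_left hbC))
    · simp only [haC, hbC, if_true, if_false] at hab
      exact absurd (hab ▸ hbC) (hlC a (ha.resolve_left haC))
    · simp only [haC, hbC, if_false] at hab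
      exact smul_left_cancel _ hab)
  have hsC : ∀ a ∈ C, s • a = a := by
    intro a ha
    rw [hs a (by simp [ha]), if_pos ha]
  have hsD : ∀ a ∈ D, s • a = (l * k⁻¹) • a := by
    intro a ha
    rw [hs a (by simp [ha]), if_neg (fun h => hkC a h ha)]
  have hsz : s • z = z := isSupport_iff.1 hC' s hsC
  have hsx : s • k • x = l • x := by
    rw [hD' s (l * k⁻¹) hsD, smul_smul, inv_mul_cancel_right]
  rw [sepProd_smul_eq g hk s hsz hsx hl, inv_smul_eq_iff, smul_smul, smul_smul]
  symm
  refine smul_eq_self_of_supp (Y.nominal _) ?_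
  intro a ha
  by_cases hax : a ∈ supp (k • x)
  · rw [mul_smul, hsD a (by rw [← hD] at hax; exact hax)]
    simp [mul_smul]
  · have had : a ∈ curryDom g z := ⟨_, hk, ha, hax⟩
    have haz : a ∈ C := by
      have := curryDom_subset g z had
      rw [← hC] at this
      exact this
    rw [mul_smul, hsC a haz, mul_smul, inv_smul_eq_iff.2 (hlD a had).symm, hkD a had]

open Classical in
/-- The separating partial function extending `x ↦ g (z, x)`. -/
noncomputable def curryFun (z : Z) : PartialMap X Y := fun x =>
  if h : ∀ a ∈ supp x, a ∉ curryDom g z then some (exists_curryRel g h).choose else none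

theorem curryFun_eq_some {z : Z} {x : X} {y : Y} :
    curryFun g z x = some y ↔ (∀ a ∈ supp x, a ∉ curryDom g z) ∧ CurryRel g z x y := by
  unfold curryFun
  split_ifs with h
  · rw [Option.some_inj]
    constructor
    · rintro rfl
      exact ⟨h, (exists_curryRel g h).choose_spec⟩
    · intro h'
      exact curryRel_unique g (exists_curryRel g h).choose_spec h'.2
  · simp [h]

theorem curryFun_isSome {z : Z} {x : X} :
    (curryFun g z x).isSome ↔ ∀ a ∈ supp x, a ∉ curryDom g z := by
  unfold curryFun
  split_ifs with h
  · exact ⟨fun _ => h, fun _ => rfl⟩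
  · exact ⟨fun h' => absurd h' (by simp), fun h' => absurd h' h⟩

theorem curryFun_of_separated {z : Z} {x : X} (h : Separated z x) :
    curryFun g z x = some (g ⟨(z, x), h⟩) := by
  rw [curryFun_eq_some]
  refine ⟨fun a ha hd => separated_iff'.1 h a (curryDom_subset g z hd) ha, 1, ?_, ?_, ?_⟩
  · rwa [one_smul]
  · intro a _
    exact one_smul _ a
  · rw [inv_one, one_smul, sepProd_smul_eq g h 1 (one_smul _ _) rfl, one_smul]

theorem curryDom_smul (k : Perm) (z : Z) {a : Atom} :
    a ∈ curryDom g (k • z) ↔ k⁻¹ • a ∈ curryDom g z := by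
  have key : ∀ (k : Perm) (z : Z) (a : Atom), a ∈ curryDom g z → k • a ∈ curryDom g (k • z) := by
    rintro k z a ⟨x, h, ha, hx⟩
    refine ⟨k • x, h.smul k, ?_, ?_⟩
    · rwa [sepProd_smul_eq g h k rfl rfl, smul_mem_supp]
    · rwa [smul_mem_supp]
  constructor
  · intro h
    have := key k⁻¹ _ _ h
    rwa [inv_smul_smul] at this
  · intro h
    have := key k _ _ h
    rwa [smul_inv_smul] at this

theorem smul_curryFun (k : Perm) (z : Z) : curryFun g (k • z) = k • curryFun g z := by
  have key : ∀ (k : Perm) (z : Z) (x : X) (y : Y), curryFun g z x = some y →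
      curryFun g (k • z) (k • x) = some (k • y) := by
    intro k z x y h
    rw [curryFun_eq_some] at h ⊢
    obtain ⟨hx, l, hl, hlD, rfl⟩ := h
    have h1 : (k * l * k⁻¹) • k • x = k • l • x := by simp [mul_smul]
    refine ⟨?_, k * l * k⁻¹, ?_, ?_, ?_⟩
    · intro a ha hd
      rw [curryDom_smul] at hd
      rw [mem_supp_smul] at ha
      exact hx _ ha hd
    · rw [h1]
      exact hl.smul k
    · intro a ha
      rw [curryDom_smul] at ha
      rw [mul_smul, mul_smul, hlD _ ha, smul_inv_smul]
    · rw [sepProd_smul_eq g hl k rfl h1.symm]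
      simp [mul_smul]
  funext x
  rw [PartialMap.smul_apply]
  ext y
  rw [Option.map_eq_some_iff]
  constructor
  · intro h
    refine ⟨k⁻¹ • y, ?_, smul_inv_smul _ _⟩
    have := key k⁻¹ _ _ _ h
    rwa [inv_smul_smul] at this
  · rintro ⟨y', hy', rfl⟩
    have := key k _ _ _ hy'
    rwa [smul_inv_smul] at this

theorem isSupport_curryFun (z : Z) :
    IsSupport Perm (curryDom_finite g z).toFinset (curryFun g z) := by
  rw [isSupport_iff]
  intro k hk
  have hk' : ∀ a ∈ curryDom g z, k • a = a := by simpa using hk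
  have hki : ∀ a ∈ curryDom g z, k⁻¹ • a = a := fun a ha => inv_smul_eq_iff.2 (hk' a ha).symm
  funext x
  ext y
  rw [PartialMap.smul_apply, Option.map_eq_some_iff]
  constructor
  · rintro ⟨y', hy', rfl⟩
    rw [curryFun_eq_some] at hy' ⊢
    obtain ⟨hx, l, hl, hlD, rfl⟩ := hy'
    refine ⟨?_, l * k⁻¹, ?_, ?_, ?_⟩
    · intro a ha hd
      refine hx (k⁻¹ • a) ?_ ?_
      · rwa [smul_mem_supp]
      · rwa [hki a hd]
    · rwa [mul_smul]
    · intro a ha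
      rw [mul_smul, hki a ha, hlD a ha]
    · have h1 := sepProd_smul_eq g hl 1 (one_smul _ _)
        (show (1 : Perm) • l • k⁻¹ • x = (l * k⁻¹) • x by rw [one_smul, mul_smul])
        (by rwa [mul_smul])
      rw [h1, mul_inv_rev, inv_inv, mul_smul, one_smul]
  · intro h
    rw [curryFun_eq_some] at h
    obtain ⟨hx, l, hl, hlD, rfl⟩ := h
    refine ⟨k⁻¹ • _, ?_, smul_inv_smul _ _⟩
    rw [curryFun_eq_some]
    have h1 : (l * k) • k⁻¹ • x = l • x := by rw [mul_smul, smul_inv_smul]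
    refine ⟨?_, l * k, ?_, ?_, ?_⟩
    · intro a ha hd
      rw [mem_supp_smul, inv_inv, hk' a hd] at ha
      exact hx a ha hd
    · rwa [h1]
    · intro a ha
      rw [mul_smul, hk' a ha, hlD a ha]
    · have h2 := sepProd_smul_eq g hl 1 (one_smul _ _)
        (show (1 : Perm) • l • x = (l * k) • k⁻¹ • x by rw [one_smul, h1])
        (by rwa [h1])
      rw [h2, mul_inv_rev, mul_smul, one_smul]

theorem supp_curryFun (z : Z) : supp (curryFun g z) = curryDom g z ∧
    curryDom g z = {a | ∃ x y, curryFun g z x = some y ∧ a ∈ supp y ∧ a ∉ supp x} := by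
  have hfs : FinSupp (curryFun g z) := ⟨_, isSupport_curryFun g z⟩
  have h1 : supp (curryFun g z) ⊆ curryDom g z := by
    have := supp_subset (isSupport_curryFun g z)
    simpa using this
  have h2 : curryDom g z ⊆
      {a | ∃ x y, curryFun g z x = some y ∧ a ∈ supp y ∧ a ∉ supp x} := by
    rintro a ⟨x, h, ha, hx⟩
    exact ⟨x, _, curryFun_of_separated g h, ha, hx⟩
  have h3 : {a | ∃ x y, curryFun g z x = some y ∧ a ∈ supp y ∧ a ∉ supp x} ⊆
      supp (curryFun g z) := by
    rintro a ⟨x, y, hxy, hy, hx⟩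
    obtain ⟨S, hS, hS'⟩ := exists_supp hfs
    obtain ⟨T, hT, hT'⟩ := exists_supp (X.nominal x)
    have hsup : IsSupport Perm (S ∪ T) y := by
      rw [isSupport_iff]
      intro k hk
      have e1 : k • curryFun g z = curryFun g z :=
        isSupport_iff.1 hS' k (fun b hb => hk b (by simp [hb]))
      have e2 : k • x = x := isSupport_iff.1 hT' k (fun b hb => hk b (by simp [hb]))
      have e3 := PartialMap.smul_apply_smul k (curryFun g z) x
      rw [e1, e2, hxy, Option.map_some, Option.some_inj] at e3
      exact e3.symm
    have := supp_subset hsup hy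
    rw [Finset.coe_union, hS, hT] at this
    exact this.resolve_right hx
  exact ⟨Set.Subset.antisymm h1 (h2.trans h3), Set.Subset.antisymm h2 (h3.trans h1)⟩

theorem isSeparating_curryFun (z : Z) : IsSeparating (curryFun g z) where
  finSupp := ⟨_, isSupport_curryFun g z⟩
  defined x := by
    rw [curryFun_isSome, separated_iff ⟨_, isSupport_curryFun g z⟩ (X.nominal x),
      (supp_curryFun g z).1]
    exact ⟨fun h a ha hb => h a hb ha, fun h a ha hb => h a hb ha⟩
  supp_eq := (supp_curryFun g z).1.trans (supp_curryFun g z).2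

/-- The transpose of `g : Z * X → Y` (separated product), a map from `Z` to the magic wand. -/
noncomputable def wandCurry : Z ⟶ wand X Y :=
  Hom.mk (X := Z) (Y := wand X Y) (fun z => ⟨curryFun g z, isSeparating_curryFun g z⟩)
    (fun k z => Subtype.ext (smul_curryFun g k z))

theorem wandCurry_apply {z : Z} {x : X} (h : Separated z x) :
    (wandCurry g z).1 x = some (g ⟨(z, x), h⟩) :=
  curryFun_of_separated g h

end Curry

/-- An element of the wand that agrees with `g (z, -)` at all fresh arguments is the transpose of
`g` at `z`. -/
theorem eq_wandCurry {Z X Y : PermNom.{u}} (g : sepProd Z X ⟶ Y) (z : Z) (f : wand X Y)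
    (h : ∀ (x : X) (hz : Separated z x), Separated f x → f.1 x = some (g ⟨(z, x), hz⟩)) :
    f = wandCurry g z := by
  obtain ⟨C, hC, -⟩ := exists_supp (Z.nominal z)
  obtain ⟨D, hD, -⟩ := exists_supp ((wand X Y).nominal f)
  refine wand_ext (C ∪ D) (fun x hx => ?_)
  have h1 : Separated z x := separated_iff'.2 (fun a ha hb => hx a hb (by
    rw [← hC] at ha; simp [Finset.mem_coe.1 ha]))
  have h2 : Separated f x := separated_iff'.2 (fun a ha hb => hx a hb (by
    rw [← hD] at ha; simp [Finset.mem_coe.1 ha]))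
  rw [wandCurry_apply g h1, h x h1 h2]

/-- The functorial action of the magic wand in its second argument: the transpose of
evaluation followed by `h`. -/
noncomputable def wandMap (X : PermNom.{u}) {Y Y' : PermNom.{u}} (h : Y ⟶ Y') :
    wand X Y ⟶ wand X Y' :=
  wandCurry (wandEv X Y ≫ h)

theorem wandMap_apply {X Y Y' : PermNom.{u}} (h : Y ⟶ Y') (f : wand X Y) {x : X}
    (hx : Separated f x) : (wandMap X h f).1 x = some (h (wandEv X Y ⟨(f, x), hx⟩)) :=
  wandCurry_apply _ hx

/-! ## Separated automata, and the lifted forgetful functor -/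

/-- The functor `S X = O × (A ⊸ X)` whose coalgebras are separated automata with input alphabet
`A` and output alphabet `O`. -/
noncomputable def sepMoore (A O : PermNom.{u}) : PermNom.{u} ⥤ PermNom.{u} where
  obj X := prod O (wand A X)
  map {X Y} h := Hom.mk (X := prod O (wand A X)) (Y := prod O (wand A Y))
    (fun p => (p.1, wandMap A h p.2))
    (fun m p => Prod.ext rfl (hom_smul (wandMap A h) m p.2))
  map_id X := Hom.ext (funext fun p => Prod.ext rfl (eq_wandCurry _ _ _
    (fun x hz _ => some_wandEv (X := A) (Y := X) ⟨(p.2, x), hz⟩)).symm)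
  map_comp {X Y Z} h k := Hom.ext (funext fun p => Prod.ext rfl (Eq.symm (eq_wandCurry _ _ _
    (fun x hz h2 => by
      obtain ⟨C, hC, -⟩ := exists_supp ((wand A X).nominal p.2)
      have h3 : Separated (wandMap A h p.2) x := by
        obtain ⟨C, D, hCD, hC, hD⟩ := hz
        exact ⟨C, D, hCD, isSupport_map _ hC, hD⟩
      refine (wandMap_apply k (wandMap A h p.2) h3).trans ?_
      have h4 := wandMap_apply h p.2 hz
      have h5 := some_wandEv (X := A) (Y := Y) ⟨(wandMap A h p.2, x), h3⟩
      have h6 := Option.some_injective _ (h5.symm.trans h4)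
      rw [h6]
      rfl))))

/-- The map `(f, x) ↦ f(1, [1, x])` on the separated product of `U(F A →_Sb Y)` and `A`. -/
def freeExpEv (A : PermNom.{u}) (Y : SbNom.{u}) :
    sepProd (forgetSb.obj (exp (free A) Y)) A ⟶ forgetSb.obj Y :=
  Hom.mk (X := sepProd (forgetSb.obj (exp (free A) Y)) A) (Y := forgetSb.obj Y)
    (fun p => exp.app (X := free A) (Y := Y) p.1.1 1 (free.mk 1 p.1.2))
    (fun g p => by
      change exp.app (X := free A) (Y := Y) p.1.1 (1 * permToSb g) (free.mk 1 (g • p.1.2)) =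
        permToSb g • exp.app (X := free A) (Y := Y) p.1.1 1 (free.mk 1 p.1.2)
      have h := exp.app_smul (X := free A) (Y := Y) p.1.1 (permToSb g) 1 (free.mk 1 p.1.2)
      rw [free.smul_mk, mul_one] at h
      rw [free.mk_smul, one_mul]
      exact h)

/-- The map `U(F A →_Sb Y) → (A ⊸ U Y)` obtained by evaluating in `Sb`-sets, precomposing with the
unit `x ↦ [1, x]` and restricting to separated arguments. -/
noncomputable def phiInv (A : PermNom.{u}) (Y : SbNom.{u}) :
    forgetSb.obj (exp (free A) Y) ⟶ wand A (forgetSb.obj Y) :=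
  wandCurry (freeExpEv A Y)

/-- The natural transformation `U B ⟶ S U` with components `id × phiInv`. -/
noncomputable def lamInv (A : PermNom.{u}) (O : SbNom.{u}) :
    moore (free A) O ⋙ forgetSb ⟶ forgetSb ⋙ sepMoore A (forgetSb.obj O) where
  app Y := Hom.mk (X := forgetSb.obj (prod O (exp (free A) Y)))
    (Y := prod (forgetSb.obj O) (wand A (forgetSb.obj Y)))
    (fun p => (p.1, phiInv A Y p.2))
    (fun g p => Prod.ext rfl (hom_smul (phiInv A Y) g p.2))
  naturality X Y h := Hom.ext (funext fun p => Prod.ext rfl (by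
    symm
    let q : forgetSb.obj (exp (free A) X) := p.2
    change wandMap A (forgetSb.map h) (phiInv A X q) =
      phiInv A Y (forgetSb.map (expMap (free A) h) q)
    obtain ⟨C, hC⟩ := (forgetSb.obj (exp (free A) X)).nominal q
    refine wand_ext C (fun x hx => ?_)
    obtain ⟨D, hD, hD'⟩ := exists_supp (A.nominal x)
    have hsep : Separated q x := ⟨C, D, by
      rw [Finset.disjoint_left]
      intro a ha hb
      exact hx a (hD ▸ hb) ha, hC, hD'⟩
    have trans : ∀ {W : PermNom.{u}} (f : forgetSb.obj (exp (free A) X) ⟶ W),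
        Separated (f q) x := by
      intro W f
      obtain ⟨C, D, hCD, hC, hD⟩ := hsep
      exact ⟨C, D, hCD, isSupport_map _ hC, hD⟩
    have h3 := trans (phiInv A X)
    have h4 := trans (forgetSb.map (expMap (free A) h))
    refine (wandMap_apply (forgetSb.map h) (phiInv A X q) h3).trans ?_
    refine Eq.trans ?_ (wandCurry_apply (freeExpEv A Y) h4).symm
    have h5 := some_wandEv (X := A) (Y := forgetSb.obj X) ⟨(phiInv A X q, x), h3⟩
    have h6 := Option.some_injective _ (h5.symm.trans (wandCurry_apply (freeExpEv A X) hsep))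
    rw [h6]
    rfl))

/-- The lifted forgetful functor from `B`-coalgebras to `S`-coalgebras: on objects,
`(X, γ) ↦ (U X, U γ ≫ lamInv)`; on morphisms it is `U`. -/
noncomputable def forgetLift (A : PermNom.{u}) (O : SbNom.{u}) :
    Endofunctor.Coalgebra (moore (free A) O) ⥤
      Endofunctor.Coalgebra (sepMoore A (forgetSb.obj O)) where
  obj C := ⟨forgetSb.obj C.V, forgetSb.map C.str ≫ (lamInv A O).app C.V⟩
  map {C D} f := ⟨forgetSb.map f.f, by
    have h := (lamInv A O).naturality f.f
    have h' := congrArg forgetSb.map f.h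
    simp only [Functor.map_comp, Functor.comp_map] at h h' ⊢
    rw [Category.assoc, ← h, ← Category.assoc, h', Category.assoc]⟩

end SepAut

namespace SepAut

open CategoryTheory CategoryTheory.Limits NomSet

/-! ## Supports with respect to substitutions and permutations -/

/-! The isomorphism rests on moving arguments to the diagonal. Given `(m, [n, x])` and a finite set
`C`, choose a permutation `g` with `g x` fresh for `C`, and glue `m` on `C` with `n g⁻¹` elsewhere
to a substitution `k`. Then `[n, x] = [k, g x]`, and if `C` supports `f` then `f(m, [n, x]) = f(k,
k[1, g x]) = k · f(1, [1, g x])`. So `f` is determined by its values at `[1, x]` for fresh `x`,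
which gives `phiInv_injective`. The same formula, `k · ψ(g x)`, extends a separating `ψ` to the
exponent. Independence of the choices (`extendRel_unique`) needs that the value of `ψ` is determined
by how a substitution acts on a `Perm`-support; `isSupport_sb` supplies this, since the values lie
in a nominal `Sb`-set.

Languages are final for the usual reason: the map sending a state to its language is the transpose
of `run`, and a coalgebra morphism has no choice about the value at any word.

Finality transfers along the lifted forgetful functor because `F` is left adjoint to `U` and
`lamInv` is invertible. A separated automaton on `X` yields a Moore automaton on `F X`, and every
morphism from the former into the image of `D` factors through the unit via a morphism into `D`. If
`D` is final, the latter exists and is unique. -/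

theorem sb_finite (m : Sb) : {a : Atom | m • a ≠ a}.Finite := m.2

/-- In a nominal `Sb`-set, every finite `Perm`-support is an `Sb`-support. -/
theorem isSupport_sb {Y : SbNom.{u}} {y : Y} {D : Finset Atom}
    (h : IsSupport Perm (X := forgetSb.obj Y) D y) : IsSupport Sb D y := by
  intro m₁ m₂ hm
  obtain ⟨C, hC⟩ := Y.nominal y
  -- Since `g` fixes `D` pointwise it fixes `y`, so `g C` is another `Sb`-support of `y`. Each of
  -- its atoms lies in `D` or is moved by neither substitution, so `m₁` and `m₂` agree on it.
  obtain ⟨g, hg, hg'⟩ := exists_fresh D C ((sb_finite m₁).toFinset ∪ (sb_finite m₂).toFinset)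
  have hy : permToSb g • y = y := isSupport_iff.1 h g hg
  have hs := hC.smul (permToSb g)
  rw [hy] at hs
  refine hs m₁ m₂ fun a ha => ?_
  obtain ⟨c, hc, rfl⟩ := Finset.mem_image.1 ha
  simp only [permToSb_smul]
  by_cases hcD : c ∈ D
  · rw [hg c hcD, hm c hcD]
  · have := hg' c hc hcD
    simp only [Finset.mem_union, Set.Finite.mem_toFinset, Set.mem_ofPred_eq, not_or,
      not_not] at this
    rw [this.1, this.2]

/-- Two substitutions can be glued along a finite set. -/
theorem exists_sb_glue (C : Finset Atom) (m n : Sb) :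
    ∃ k : Sb, (∀ a ∈ C, k • a = m • a) ∧ ∀ a ∉ C, k • a = n • a := by
  refine ⟨⟨fun a => if a ∈ C then m • a else n • a, ?_⟩, ?_, ?_⟩
  · refine ((sb_finite m).union (sb_finite n)).subset fun a ha => ?_
    by_cases haC : a ∈ C
    · exact Or.inl (by simpa [haC] using ha)
    · exact Or.inr (by simpa [haC] using ha)
  · intro a ha
    exact if_pos ha
  · intro a ha
    exact if_neg ha

/-- Given `m` and `[n, x]`, there is a fresh copy `g x` of `x` and a substitution that agrees with
`m` on `C` and satisfies `[n, x] = [k, g x]`. -/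
theorem exists_fresh_glue {X : PermNom.{u}} (C : Finset Atom) (m n : Sb) (x : X) :
    ∃ (g : Perm) (k : Sb), (∀ a ∈ supp (g • x), a ∉ C) ∧ (∀ a ∈ C, k • a = m • a) ∧
      ∀ a ∈ supp x, k • g • a = n • a := by
  obtain ⟨g, -, hg⟩ := exists_fresh_supp (X.nominal x) ∅ C (by simp)
  -- The support of `g x` avoids `C`, so on it `k` is `n g⁻¹` and `k g` acts on the support of `x`
  -- as `n` does.
  obtain ⟨k, hk, hk'⟩ := exists_sb_glue C m (n * permToSb g⁻¹)
  refine ⟨g, k, hg, hk, fun a ha => ?_⟩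
  rw [hk' _ (hg _ ((smul_mem_supp g).2 ha)), mul_smul, permToSb_smul, inv_smul_smul]

theorem free.mk_eq_of_agree {X : PermNom.{u}} {m n : Sb} {x : X}
    (h : ∀ a ∈ supp x, m • a = n • a) : free.mk m x = free.mk n x := by
  obtain ⟨S, hS, hS'⟩ := exists_supp (X.nominal x)
  exact Quot.sound (FreeRel.agree m n x S hS' fun a ha => h a (hS ▸ ha))

theorem free.mk_smul_eq {X : PermNom.{u}} {k n : Sb} {g : Perm} {x : X}
    (h : ∀ a ∈ supp x, k • g • a = n • a) : free.mk k (g • x) = free.mk n x := by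
  rw [free.mk_smul]
  exact free.mk_eq_of_agree fun a ha => by rw [mul_smul, permToSb_smul, h a ha]

/-! ## The isomorphism between the exponent and the magic wand -/

theorem phiInv_apply {A : PermNom.{u}} {Y : SbNom.{u}} {f : forgetSb.obj (exp (free A) Y)} {x : A}
    (h : Separated f x) :
    (phiInv A Y f).1 x = some (exp.app (X := free A) (Y := Y) f 1 (free.mk 1 x)) :=
  wandCurry_apply (freeExpEv A Y) h

theorem NomSet.exp.app_diag {X Y : SbNom.{u}} (f : exp X Y) (m : Sb) (x : X) :
    exp.app f m (m • x) = m • exp.app f 1 x := by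
  have := exp.app_smul f m 1 x
  rwa [mul_one] at this

/-- Because `f(m, x) = (m · f)(1, x)`, the first argument matters only through its restriction to a
support of `f`. -/
theorem NomSet.exp.app_congr {X Y : SbNom.{u}} {f : exp X Y} {C : Finset Atom}
    (hC : IsSupport Sb C f) {m n : Sb} (h : ∀ a ∈ C, m • a = n • a) (x : X) :
    exp.app f m x = exp.app f n x := by
  have h1 := congrArg (fun e => exp.app e 1 x) (hC m n h)
  simpa only [exp.smul_app, one_mul] using h1

/-- The fresh copy `g x` and the substitution `k` are chosen for the supports of both functions at
once, so both values at `(m, [n, x])` are `k` applied to their images under `phiInv` at the same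
point `g x`. -/
theorem phiInv_injective (A : PermNom.{u}) (Y : SbNom.{u}) :
    Function.Injective (phiInv A Y) := by
  intro f f' hff
  refine exp.ext (X := free A) (Y := Y) fun m p => ?_
  obtain ⟨n, x⟩ := p
  obtain ⟨C, hC⟩ := (exp (free A) Y).nominal f
  obtain ⟨C', hC'⟩ := (exp (free A) Y).nominal f'
  obtain ⟨g, k, hg, hk, hkg⟩ := exists_fresh_glue (C ∪ C') m n x
  obtain ⟨D, hD, hD'⟩ := exists_supp (A.nominal (g • x))
  have hp : free.mk n x = k • free.mk 1 (g • x) := by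
    rw [free.smul_mk, mul_one, free.mk_smul_eq hkg]
  have key : ∀ (e : forgetSb.obj (exp (free A) Y)) (E : Finset Atom),
      IsSupport Sb (X := exp (free A) Y) E e → E ⊆ C ∪ C' → ∃ y : Y, (phiInv A Y e).1 (g • x) = some y ∧
        exp.app (X := free A) (Y := Y) e m (free.mk n x) = k • y := by
    intro e E hE hsub
    have hsep : Separated e (g • x) := by
      refine ⟨E, D, ?_, fun a b hab => hE (permToSb a) (permToSb b) hab, hD'⟩
      rw [Finset.disjoint_left]
      intro a ha hb
      exact hg a (hD ▸ hb) (hsub ha)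
    refine ⟨_, phiInv_apply hsep, ?_⟩
    rw [hp]
    exact (exp.app_congr (X := free A) (Y := Y) hE (fun a ha => (hk a (hsub ha)).symm) _).trans
      (exp.app_diag (X := free A) (Y := Y) e k _)
  obtain ⟨y, hy, h1⟩ := key f C hC Finset.subset_union_left
  obtain ⟨y', hy', h2⟩ := key f' C' hC' Finset.subset_union_right
  rw [hff] at hy
  have hyy : y = y' := Option.some_injective _ (hy.symm.trans hy')
  exact h1.trans ((congrArg (fun y : Y => k • y) hyy).trans h2.symm)

/-! ### Extending a separating partial function to the exponent -/

section Extend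

variable {A : PermNom.{u}} {Y : SbNom.{u}} (ψ : wand A (forgetSb.obj Y))

/-- `y` is the value at `(m, [n, x])` of the extension of `ψ` to an element of the exponent: it is
`k · ψ (g x)` for a fresh copy `g x` of `x` and a substitution `k` that agrees with `m` on the
support of `ψ` and satisfies `[n, x] = [k, g x]`. -/
def ExtendRel (m : Sb) (p : Sb × A) (y : Y) : Prop :=
  ∃ (g : Perm) (k : Sb) (z : Y), ψ.1 (g • p.2) = some z ∧ (∀ a ∈ supp ψ, k • a = m • a) ∧
    (∀ a ∈ supp p.2, k • g • a = p.1 • a) ∧ y = k • z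

theorem exists_extendRel (m : Sb) (p : Sb × A) : ∃ y, ExtendRel ψ m p y := by
  obtain ⟨C, hC, -⟩ := exists_supp ((wand A (forgetSb.obj Y)).nominal ψ)
  obtain ⟨g, k, hg, hk, hkg⟩ := exists_fresh_glue C m p.1 p.2
  have hsep : Separated ψ (g • p.2) :=
    separated_iff'.2 fun a ha hb => hg a hb (by rw [← hC] at ha; exact ha)
  exact ⟨_, g, k, _, some_wandEv ⟨(ψ, g • p.2), hsep⟩,
    fun a ha => hk a (by rw [← hC] at ha; exact ha), hkg, rfl⟩

theorem separated_of_eq_some {x : A} {y : forgetSb.obj Y} (h : ψ.1 x = some y) :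
    ∀ a ∈ supp ψ, a ∉ supp x :=
  separated_iff'.1 (separated_wand.2 ((ψ.2.defined x).1 (by rw [h]; rfl)))

/-- A permutation fixing `ψ` and `x` fixes the value, by equivariance of evaluation. This provides
the `Perm`-support to which `isSupport_sb` is applied in `extendRel_unique`. -/
theorem isSupport_wand_value {x : A} {y : forgetSb.obj Y} (h : ψ.1 x = some y) {C D : Finset Atom}
    (hC : IsSupport Perm C ψ) (hD : IsSupport Perm D x) : IsSupport Perm (C ∪ D) y := by
  rw [isSupport_iff]
  intro k hk
  have e1 : k • ψ.1 = ψ.1 := isSupport_iff.1 (isSupport_wand.1 hC) k fun b hb => hk b (by simp [hb])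
  have e2 : k • x = x := isSupport_iff.1 hD k fun b hb => hk b (by simp [hb])
  have e3 := PartialMap.smul_apply_smul k ψ.1 x
  rw [e1, e2, h, Option.map_some, Option.some_inj] at e3
  exact e3.symm

/-- Two fresh copies of `x` are related by a finite permutation `s` fixing the support of `ψ`, so
`ψ(g' x) = s · ψ(g x)`. It remains to compare the substitutions `k` and `k' s` on a support of `ψ(g
x)`. -/
theorem extendRel_unique {m : Sb} {p : Sb × A} {y y' : Y} (h : ExtendRel ψ m p y)
    (h' : ExtendRel ψ m p y') : y = y' := by
  obtain ⟨n, x⟩ := p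
  obtain ⟨g, k, z, hz, hk, hkg, rfl⟩ := h
  obtain ⟨g', k', z', hz', hk', hkg', rfl⟩ := h'
  obtain ⟨C, hC, hC'⟩ := exists_supp ((wand A (forgetSb.obj Y)).nominal ψ)
  obtain ⟨D, hD, hD'⟩ := exists_supp (A.nominal (g • x))
  have hCD : ∀ a ∈ C, a ∉ D := fun a ha hb =>
    separated_of_eq_some ψ hz a (by rw [← hC]; exact ha) (by rw [← hD]; exact hb)
  have hmem : ∀ a ∈ D, g⁻¹ • a ∈ supp x := fun a ha => by
    rw [← mem_supp_smul, ← hD]; exact ha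
  have hCD' : ∀ a ∈ D, (g' * g⁻¹) • a ∉ C := fun a ha hb =>
    separated_of_eq_some ψ hz' _ (by rw [← hC]; exact hb)
      (by rw [mul_smul, smul_mem_supp]; exact hmem a ha)
  -- The prescribed map is injective because `g' g⁻¹` sends `D` outside `C`, as `g' x` is fresh for
  -- `ψ`. Freshness of `g x` makes `C` and `D` disjoint, so the second branch applies on all of `D`.
  obtain ⟨s, hs⟩ := exists_extend (C ∪ D) (fun a => if a ∈ C then a else (g' * g⁻¹) • a) (by
    intro a ha b hb hab
    simp only [Finset.coe_union, Set.mem_union, Finset.mem_coe] at ha hb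
    by_cases haC : a ∈ C <;> by_cases hbC : b ∈ C
    · simpa [haC, hbC] using hab
    · simp only [haC, hbC, if_true, if_false] at hab
      exact absurd (hab ▸ haC) (hCD' b (hb.resolve_left hbC))
    · simp only [haC, hbC, if_true, if_false] at hab
      exact absurd (hab ▸ hbC) (hCD' a (ha.resolve_left haC))
    · simp only [haC, hbC, if_false] at hab
      exact smul_left_cancel _ hab)
  have hsC : ∀ a ∈ C, s • a = a := fun a ha => by rw [hs a (by simp [ha]), if_pos ha]
  have hsD : ∀ a ∈ D, s • a = (g' * g⁻¹) • a := fun a ha => by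
    rw [hs a (by simp [ha]), if_neg fun h => hCD a h ha]
  have hsx : s • g • x = g' • x := by
    rw [hD' s (g' * g⁻¹) hsD, smul_smul, inv_mul_cancel_right]
  have hzz : z' = permToSb s • z := by
    have h1 := PartialMap.smul_apply_smul s ψ.1 (g • x)
    rw [isSupport_iff.1 (isSupport_wand.1 hC') s hsC, hsx, hz] at h1
    exact Option.some_injective _ (hz'.symm.trans h1)
  rw [hzz, smul_smul]
  -- On `C` both `k` and `k' s` act as `m`; on `D`, the support of `g x`, both act as `n g⁻¹`.
  refine isSupport_sb (isSupport_wand_value ψ hz hC' hD') _ _ fun a ha => ?_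
  rw [mul_smul, permToSb_smul]
  rcases Finset.mem_union.1 ha with ha | ha
  · have := (hC ▸ ha : a ∈ supp ψ)
    rw [hsC a ha, hk a this, hk' a this]
  · have h1 := hkg _ (hmem a ha)
    have h2 := hkg' _ (hmem a ha)
    rw [smul_inv_smul] at h1
    rw [hsD a ha, mul_smul, h1, h2]

/-- One direction is enough for lifting to the quotient, since `extendRel_unique` then identifies
the chosen values. Only the permutation changes, and only for the generator that moves `l` across
the pair: `g` becomes `g l`. -/
theorem ExtendRel.congr {m : Sb} {p q : Sb × A} (hpq : FreeRel A p q) {y : Y}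
    (h : ExtendRel ψ m p y) : ExtendRel ψ m q y := by
  obtain ⟨g, k, z, hz, hk, hkg, rfl⟩ := h
  rcases hpq with ⟨n, l, x⟩ | ⟨n, n', x, C, hC, hn⟩
  · refine ⟨g * l, k, z, ?_, hk, fun a ha => ?_, rfl⟩
    · rw [← hz, mul_smul]
    · rw [mul_smul, mul_smul, permToSb_smul]
      exact hkg _ ((smul_mem_supp l).2 ha)
  · refine ⟨g, k, z, hz, hk, fun a ha => ?_, rfl⟩
    exact (hkg a ha).trans (hn a (supp_subset hC ha))

/-- The function underlying the extension of `ψ` to an element of the exponent. -/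
noncomputable def extendFun (m : Sb) (p : free A) : Y :=
  Quot.lift (fun q => (exists_extendRel ψ m q).choose) (fun q q' hqq =>
    extendRel_unique ψ ((exists_extendRel ψ m q).choose_spec.congr ψ hqq)
      (exists_extendRel ψ m q').choose_spec) p

theorem extendFun_eq {m n : Sb} {x : A} {y : Y} (h : ExtendRel ψ m (n, x) y) :
    extendFun ψ m (free.mk n x) = y :=
  extendRel_unique ψ (exists_extendRel ψ m (n, x)).choose_spec h

theorem extendRel_extendFun (m n : Sb) (x : A) :
    ExtendRel ψ m (n, x) (extendFun ψ m (free.mk n x)) :=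
  (exists_extendRel ψ m (n, x)).choose_spec

/-- The extension of a separating partial function to an element of the exponent. -/
noncomputable def extend : exp (free A) Y :=
  ⟨⟨fun p => extendFun ψ p.1 p.2, by
    rintro k m ⟨n, x⟩
    obtain ⟨g, l, z, hz, hl, hlg, hy⟩ := extendRel_extendFun ψ m n x
    -- Equivariance: the same fresh copy serves, with the substitution multiplied by `k` on the
    -- left.
    refine extendFun_eq ψ (n := k * n) ⟨g, k * l, z, hz, fun a ha => ?_, fun a ha => ?_, ?_⟩
    · rw [mul_smul, hl a ha, mul_smul]
    · rw [mul_smul, hlg a ha, mul_smul]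
    · exact (congrArg (fun y : Y => k • y) hy).trans (smul_smul k l z)⟩, by
    obtain ⟨C, hC, -⟩ := exists_supp ((wand A (forgetSb.obj Y)).nominal ψ)
    refine ⟨C, fun m₁ m₂ hm => Subtype.ext (funext ?_)⟩
    rintro ⟨k, n, x⟩
    obtain ⟨g, l, z, hz, hl, hlg, hy⟩ := extendRel_extendFun ψ (k * m₂) n x
    -- A witness for `k m₂` is also one for `k m₁`, since the condition only tests the support of
    -- `ψ`, where `m₁` and `m₂` agree.
    refine (extendFun_eq ψ (m := k * m₁) ⟨g, l, z, hz, fun a ha => ?_, hlg, rfl⟩).trans hy.symm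
    rw [hl a ha, mul_smul, mul_smul, hm a (by rw [← hC] at ha; exact ha)]⟩

/-- On the diagonal, with `x` already fresh for `ψ`, no new copy is needed: the witnesses are `g =
1` and `k = m`. -/
theorem extend_app {x : A} {y : Y} (h : ψ.1 x = some y) (m : Sb) :
    exp.app (extend ψ) m (free.mk m x) = m • y :=
  extendFun_eq ψ ⟨1, m, y, by rwa [one_smul], fun _ _ => rfl, fun a _ => by rw [one_smul], rfl⟩

theorem phiInv_extend : phiInv A Y (extend ψ) = ψ := by
  symm
  refine eq_wandCurry (freeExpEv A Y) _ ψ fun x _ hx => ?_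
  have h := some_wandEv ⟨(ψ, x), hx⟩
  refine h.trans (congrArg some ?_)
  exact ((extend_app ψ h 1).trans (one_smul Sb _)).symm

end Extend

/-- The isomorphism `(A ⊸ U Y) ⟶ U (F A →_Sb Y)`. -/
noncomputable def phi (A : PermNom.{u}) (Y : SbNom.{u}) :
    wand A (forgetSb.obj Y) ⟶ forgetSb.obj (exp (free A) Y) :=
  Hom.mk (X := wand A (forgetSb.obj Y)) (Y := forgetSb.obj (exp (free A) Y)) extend
    -- A section of an injective equivariant map is itself equivariant.
    (fun g ψ => phiInv_injective A Y (by
      rw [hom_smul (phiInv A Y) g (extend ψ), phiInv_extend, phiInv_extend]))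

theorem phi_phiInv (A : PermNom.{u}) (Y : SbNom.{u}) : phi A Y ≫ phiInv A Y = 𝟙 _ :=
  Hom.ext (funext phiInv_extend)

/-- A right inverse of an injective map is two-sided. -/
theorem phiInv_phi (A : PermNom.{u}) (Y : SbNom.{u}) : phiInv A Y ≫ phi A Y = 𝟙 _ :=
  Hom.ext (funext fun f => phiInv_injective A Y (phiInv_extend (phiInv A Y f)))

/-- Needed twice for the transfer of finality: the inverse component at `F X` defines the structure
of `freeCoalg`, and the component at `D.V` is cancelled in `freeCoalgLift`. -/
instance (A : PermNom.{u}) (O Y : SbNom.{u}) : IsIso ((lamInv A O).app Y) :=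
  ⟨Hom.mk (X := prod (forgetSb.obj O) (wand A (forgetSb.obj Y)))
    (Y := forgetSb.obj (prod O (exp (free A) Y)))
    (fun p => (p.1, phi A Y p.2)) (fun g p => Prod.ext rfl (hom_smul (phi A Y) g p.2)),
    Hom.ext (funext fun p => Prod.ext rfl (ConcreteCategory.congr_hom (phiInv_phi A Y) p.2)),
    Hom.ext (funext fun p => Prod.ext rfl (ConcreteCategory.congr_hom (phi_phiInv A Y) p.2))⟩

instance (A : PermNom.{u}) (O : SbNom.{u}) : IsIso (lamInv A O) :=
  NatIso.isIso_of_isIso_app _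

/-! ## Finality of the automaton of languages -/

section Languages

variable {M : Type} [Monoid M] [MulAction M Atom] {A O : NomSet.{u} M}

theorem exp_app_smul_one {X Y : NomSet.{u} M} (f : exp X Y) (m : M) (x : X) :
    exp.app (m • f) 1 x = exp.app f m x := by
  rw [exp.smul_app, one_mul]

theorem exp_app_smul_smul {X Y : NomSet.{u} M} (f : exp X Y) (m : M) (x : X) :
    exp.app (m • f) 1 (m • x) = m • exp.app f 1 x := by
  have h := exp.app_smul f m 1 x
  rwa [mul_one, ← exp_app_smul_one] at h

variable (C : Endofunctor.Coalgebra (moore A O))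

/-- The output of a state of a Moore automaton. -/
def out (x : C.V) : O := (C.str x : O × exp A C.V).1

/-- The curried transition function of a Moore automaton. -/
def next (x : C.V) : exp A C.V := (C.str x : O × exp A C.V).2

theorem out_smul (m : M) (x : C.V) : out C (m • x) = m • out C x :=
  congrArg Prod.fst (hom_smul C.str m x)

theorem next_smul (m : M) (x : C.V) : next C (m • x) = m • next C x :=
  congrArg Prod.snd (hom_smul C.str m x)

/-- The output of a Moore automaton after reading a word. -/
def run (x : C.V) : List A → O
  | [] => out C x
  | a :: w => run (exp.app (next C x) 1 a) w

theorem run_smul (m : M) (x : C.V) (w : List A) :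
    run C (m • x) (w.map fun a => m • a) = m • run C x w := by
  induction w generalizing x with
  | nil => exact out_smul C m x
  | cons a w ih =>
    rw [List.map_cons, run, run, next_smul, exp_app_smul_smul, ih]

/-- The language map, as a map from states and words to outputs. -/
def runHom : prod C.V (words A) ⟶ O :=
  Hom.mk (X := prod C.V (words A)) (Y := O) (fun p => run C p.1 p.2)
    (fun m p => run_smul C m p.1 p.2)

theorem out_map {C D : Endofunctor.Coalgebra (moore A O)} (f : C ⟶ D) (x : C.V) :
    out D (f.f x) = out C x :=
  (congrArg Prod.fst (ConcreteCategory.congr_hom f.h x)).symm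

theorem next_map {C D : Endofunctor.Coalgebra (moore A O)} (f : C ⟶ D) (x : C.V) :
    next D (f.f x) = expMap A f.f (next C x) :=
  (congrArg Prod.snd (ConcreteCategory.congr_hom f.h x)).symm

/-- Two nested transposes are unfolded: the outer one contributes `m`, the inner one `n`. For `m =
1` this is the formula for `δ(L, a)(n, w)`. -/
theorem next_langCoalg (L : exp (words A) O) (m n : M) (a : A) (w : List A) :
    exp.app (exp.app (next (langCoalg A O) L) m a : exp (words A) O) n w =
      exp.app L (n * m) (n • a :: w : List A) := by
  change exp.app (n • m • L) 1 (n • a :: w : List A) = _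
  rw [smul_smul]
  exact exp_app_smul_one (X := words A) (Y := O) L (n * m) (n • a :: w : List A)

/-- The coalgebra morphism sending a state to its language. -/
def language : C ⟶ langCoalg A O where
  f := curry (runHom C)
  h := Hom.ext (funext fun x => Prod.ext
    -- The output of a language is its value at `(1, ε)`, which `curry` computes at the state `1 •
    -- x`, not `x`.
    ((congrArg (out C) (one_smul M x)).symm) (exp.ext fun m a =>
      exp.ext (X := words A) (Y := O) fun n w => by
        refine Eq.trans ?_ (next_langCoalg (curry (runHom C) x) m n a w).symm
        -- By equivariance, reading `n a` in state `n m x` leads to `n` applied to the successor of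
        -- `m x` under `a`.
        change run C (n • exp.app (next C x) m a) w =
          run C (exp.app (next C ((n * m) • x)) 1 (n • a)) w
        rw [mul_smul, next_smul, exp_app_smul_smul, next_smul, exp_app_smul_one]))

/-- Preservation of outputs settles the empty word; preservation of transitions reduces `a w` at `x`
to `w` at the successor of `x`, which is why `x` is generalized in the induction. -/
theorem app_one_eq_run (f : C ⟶ langCoalg A O) (x : C.V) (w : List A) :
    exp.app (f.f x : exp (words A) O) 1 w = run C x w := by
  induction w generalizing x with
  | nil => exact out_map f x
  | cons a w ih =>
    have h := next_langCoalg (f.f x) 1 1 a w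
    rw [next_map f x] at h
    rw [run, ← ih]
    refine Eq.trans ?_ h.symm
    rw [one_smul, one_mul]

/-- Values at `1` suffice: the value of `f(x)` at `m` is that of `m · f(x) = f(m x)` at `1`. -/
theorem eq_language (f : C ⟶ langCoalg A O) : f = language C :=
  Endofunctor.Coalgebra.Hom.ext (Hom.ext (funext fun x => exp.ext (X := words A) (Y := O)
    fun m w => by
      have h := app_one_eq_run C f (m • x) w
      rw [hom_smul f.f m x] at h
      exact (exp_app_smul_one (X := words A) (Y := O) (f.f x) m w).symm.trans h))

/-- The automaton of languages is a final Moore automaton. -/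
def langCoalgIsTerminal (A O : NomSet.{u} M) : IsTerminal (langCoalg A O) :=
  IsTerminal.ofUniqueHom language eq_language

end Languages

/-! ## The universal property of the free nominal `Sb`-set -/

/-- The unit `x ↦ [1, x]`. -/
def free.unit (X : PermNom.{u}) : X ⟶ forgetSb.obj (free X) :=
  Hom.mk (X := X) (Y := forgetSb.obj (free X)) (fun x => free.mk 1 x) (fun g x => by
    rw [free.mk_smul, one_mul]
    change _ = permToSb g • free.mk 1 x
    rw [free.smul_mk, mul_one])

/-- The transpose `[m, x] ↦ m · h(x)` of a map `h : X ⟶ U Z`. -/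
def free.lift {X : PermNom.{u}} {Z : SbNom.{u}} (h : X ⟶ forgetSb.obj Z) : free X ⟶ Z :=
  Hom.mk (X := free X) (Y := Z)
    (Quot.lift (fun p => p.1 • (show Z from h p.2)) (by
      rintro _ _ (⟨m, g, x⟩ | ⟨m, m', x, C, hC, hm⟩)
      · exact (congrArg (fun z : Z => m • z) (hom_smul h g x)).trans (smul_smul m (permToSb g) _)
      -- Equivariance of `h` only makes `C` a `Perm`-support of `h x`; comparing the substitutions
      -- `m` and `m'` requires an `Sb`-support.
      · exact isSupport_sb (isSupport_map h hC) m m' hm))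
    (by
      rintro k ⟨m, x⟩
      exact mul_smul k m _)

theorem free.unit_lift {X : PermNom.{u}} {Z : SbNom.{u}} (h : X ⟶ forgetSb.obj Z) :
    free.unit X ≫ forgetSb.map (free.lift h) = h :=
  Hom.ext (funext fun x => one_smul Sb (show Z from h x))

/-- The elements `[1, x]` generate `F X` under `Sb`, as `[m, x] = m · [1, x]`. -/
theorem free.hom_ext {X : PermNom.{u}} {Z : SbNom.{u}} {f g : free X ⟶ Z}
    (h : free.unit X ≫ forgetSb.map f = free.unit X ≫ forgetSb.map g) : f = g := by
  refine Hom.ext (funext ?_)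
  rintro ⟨m, x⟩
  have h1 : f (free.mk 1 x) = g (free.mk 1 x) := ConcreteCategory.congr_hom h x
  have h2 : free.mk m x = m • free.mk 1 x := by rw [free.smul_mk, mul_one]
  change f (free.mk m x) = g (free.mk m x)
  rw [h2, hom_smul, hom_smul, h1]

/-! ## The lifted forgetful functor preserves finality -/

section Lift

variable {A : PermNom.{u}} {O : SbNom.{u}}
  (C : Endofunctor.Coalgebra (sepMoore A (forgetSb.obj O)))

/-- The Moore automaton on `F X` determined by a separated automaton on `X`. -/
noncomputable def freeCoalg : Endofunctor.Coalgebra (moore (free A) O) where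
  V := free C.V
  -- The transpose of `X ⟶ S X ⟶ S U F X ≅ U B F X`.
  str := free.lift (C.str ≫ (sepMoore A (forgetSb.obj O)).map (free.unit C.V) ≫
    inv ((lamInv A O).app (free C.V)))

/-- The unit as a morphism of separated automata. -/
noncomputable def freeCoalgUnit : C ⟶ (forgetLift A O).obj (freeCoalg C) where
  f := free.unit C.V
  h := by
    change C.str ≫ _ = free.unit C.V ≫ forgetSb.map (free.lift _) ≫ (lamInv A O).app (free C.V)
    rw [← Category.assoc (free.unit C.V), free.unit_lift, Category.assoc, Category.assoc,
      IsIso.inv_hom_id]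
    exact congrArg (C.str ≫ ·) (Category.comp_id _).symm

/-- The transpose of a morphism of separated automata. -/
noncomputable def freeCoalgLift {D : Endofunctor.Coalgebra (moore (free A) O)}
    (f : C ⟶ (forgetLift A O).obj D) : freeCoalg C ⟶ D where
  f := free.lift (X := C.V) (Z := D.V) f.f
  h := by
    let l : free C.V ⟶ D.V := free.lift (X := C.V) (Z := D.V) f.f
    have hl : free.unit C.V ≫ forgetSb.map l = f.f := free.unit_lift (Z := D.V) f.f
    change free.lift _ ≫ (moore (free A) O).map l = l ≫ D.str
    -- After restriction along the unit and composition with the invertible component of `lamInv` at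
    -- `D.V`, naturality trades `U B l` for `S U l`. The inverse in the structure of `freeCoalg`
    -- then cancels, leaving the coalgebra square of `f`.
    apply free.hom_ext
    have nat := (lamInv A O).naturality l
    have hf : C.str ≫ (sepMoore A (forgetSb.obj O)).map f.f =
      f.f ≫ forgetSb.map D.str ≫ (lamInv A O).app D.V := f.h
    rw [Functor.map_comp, Functor.map_comp, ← Category.assoc, free.unit_lift,
      ← Category.assoc (free.unit C.V) (forgetSb.map l), hl, ← cancel_mono ((lamInv A O).app D.V)]
    simp only [Functor.comp_map] at nat
    rw [Category.assoc, Category.assoc, Category.assoc, nat, IsIso.inv_hom_id_assoc,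
      ← Functor.map_comp, hl]
    exact hf.trans (Category.assoc _ _ _).symm

theorem unit_freeCoalgLift {D : Endofunctor.Coalgebra (moore (free A) O)}
    (f : C ⟶ (forgetLift A O).obj D) :
    freeCoalgUnit C ≫ (forgetLift A O).map (freeCoalgLift C f) = f :=
  Endofunctor.Coalgebra.Hom.ext (free.unit_lift (X := C.V) (Z := D.V) f.f)

/-- The lifted forgetful functor preserves final coalgebras. -/
noncomputable def forgetLiftIsTerminal {D : Endofunctor.Coalgebra (moore (free A) O)}
    (hD : IsTerminal D) : IsTerminal ((forgetLift A O).obj D) :=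
  IsTerminal.ofUniqueHom (fun C => freeCoalgUnit C ≫ (forgetLift A O).map (hD.from (freeCoalg C)))
    -- Only existence of the factorization through the unit is used here; its second factor is a
    -- morphism into the final `D`, hence is `hD.from`.
    (fun C f => by rw [← hD.hom_ext (freeCoalgLift C f) (hD.from _), unit_freeCoalgLift])

end Lift

end SepAut

open CategoryTheory CategoryTheory.Limits SepAut SepAut.NomSet in
theorem corollary4p13 (A : PermNom.{u}) (O : SbNom.{u}) :
    -- the maps `phiInv` used in the lifting are inverse to the canonical maps `φ`
    (∀ Y : SbNom.{u}, ∃ φ : wand A (forgetSb.obj Y) ⟶ forgetSb.obj (exp (free A) Y),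
      (∀ (ψ : wand A (forgetSb.obj Y)) (x : A) (h : Separated ψ x) (m : Sb),
        let y : Y := wandEv A (forgetSb.obj Y) ⟨(ψ, x), h⟩
        exp.app (X := free A) (Y := Y) (φ ψ) m (free.mk m x) = m • y) ∧
      φ ≫ phiInv A Y = 𝟙 _ ∧ phiInv A Y ≫ φ = 𝟙 _) ∧
    -- the automaton of `Sb`-nominal languages is final among `B`-coalgebras
    Nonempty (IsTerminal (langCoalg (free A) O)) ∧
    -- its image under the lifted forgetful functor is a final separated automaton
    Nonempty (IsTerminal ((forgetLift A O).obj (langCoalg (free A) O))) ∧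
    -- and is carried by the set of `Sb`-nominal languages
    ((forgetLift A O).obj (langCoalg (free A) O)).V =
      forgetSb.obj (exp (words (free A)) O) :=
  ⟨fun Y => ⟨phi A Y, fun ψ x h m => extend_app ψ (some_wandEv ⟨(ψ, x), h⟩) m, phi_phiInv A Y,
    phiInv_phi A Y⟩, ⟨langCoalgIsTerminal _ _⟩,
    ⟨forgetLiftIsTerminal (langCoalgIsTerminal _ _)⟩, rfl⟩
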